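/- Let $X=[-1,1]$ carry the Euclidean metric and Lebesgue measure, and let $L^2([-1,1])$ be the real Hilbert space of square-integrable functions. Let $$\operatorname{Dom}\mathcal E=\Big\{f\in L^2([-1,1]) : \int_{-1}^1\int_{-1}^1\frac{|f(x)-f(y)|^2}{|x-y|}\,dy\,dx<\infty\Big\},\qquad \mathcal E(f,g)=\frac12\int_{-1}^1\int_{-1}^1\frac{(f(x)-f(y))(g(x)-g(y))}{|x-y|}\,dy\,dx,$$ and let $\Delta$ (the logarithmic Dirichlet Laplacian) be the positive self-adjoint operator associated to the closed form $\mathcal E$: $u\in\operatorname{Dom}\Delta$ and $\Delta u=v$ if and only if $u\in\operatorname{Dom}\mathcal E$ and $\mathcal E(u,g)=\langle v,g\rangle_{L^2}$ for all $g\in\operatorname{Dom}\mathcal E$. For $n\ge 0$ let $p_n(x)=\frac1{2^n n!}\frac{d^n}{dx^n}(x^2-1)^n$ be the $n$-th Legendre polynomial and $h_n=\sum_{k=1}^n\frac1k$ the $n$-th harmonic number (so $h_0=0$). Let $(e^{-t\Delta})_{t\ge0}$ be the heat semigroup of $\Delta$, i.e. the unique strongly continuous one-parameter semigroup of bounded operators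 on $L^2([-1,1])$ with infinitesimal generator $-\Delta$. Then: 1. for every $n\ge 0$, $p_n\in\operatorname{Dom}\Delta$ and $\Delta p_n=2h_np_n$; 2. the Lipschitz functions on $[-1,1]$ are a core for $\Delta$: they lie in $\operatorname{Dom}\Delta$, and $\Delta$ is the closure of its restriction to them; 3. the semigroup $e^{-t\Delta}$ exists and is unique; $e^{-t\Delta}$ is compact for every $t>0$; and, for $t\ge0$, $e^{-t\Delta}$ is trace class if and only if $t>\frac12$. -/

import Mathlib

open MeasureTheory Filter Topology
open scoped NNReal

set_option linter.unusedSectionVars false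

noncomputable section

namespace LogLaplacian

/-! ### The operator of a bilinear form -/

section FormOperator

variable {H : Type*} [NormedAddCommGroup H] [InnerProductSpace ℝ H]

/-- The pairs `(u, v)` with `u ∈ D` and `Q(u, g) = ⟪v, g⟫` for all `g ∈ D`. Writing `v = f - u`,
this says `⟪u, g⟫ + Q(u, g) = ⟪f, g⟫` for all `g ∈ D`, that is `u = R f` for the Riesz operator
`R : H → D` of the inner product `⟪·,·⟫ + Q` on `D`, and `v = f - R f`. -/
def formGraph (D : Submodule ℝ H) (Q : D →ₗ[ℝ] D →ₗ[ℝ] ℝ) : Submodule ℝ (H × H) where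
  carrier := {p | ∃ u : D, (u : H) = p.1 ∧ ∀ g : D, Q u g = inner ℝ p.2 (g : H)}
  add_mem' := by
    rintro p q ⟨u, hu, hu'⟩ ⟨w, hw, hw'⟩
    refine ⟨u + w, by simp [hu, hw], fun g => ?_⟩
    simp [hu' g, hw' g, inner_add_left]
  zero_mem' := ⟨0, by simp, fun g => by simp⟩
  smul_mem' := by
    rintro c p ⟨u, hu, hu'⟩
    refine ⟨c • u, by simp [hu], fun g => ?_⟩
    simp [hu' g, inner_smul_left]

/-- The (unbounded) operator `A` associated to a densely defined form `Q` with domain `D`: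
`u ∈ Dom A` and `A u = v` iff `u ∈ D` and `Q(u, g) = ⟪v, g⟫` for all `g ∈ D`. -/
def formOperator (D : Submodule ℝ H) (Q : D →ₗ[ℝ] D →ₗ[ℝ] ℝ) : H →ₗ.[ℝ] H :=
  (formGraph D Q).toLinearPMap

theorem formOperator_graph (D : Submodule ℝ H) (Q : D →ₗ[ℝ] D →ₗ[ℝ] ℝ)
    (hD : Dense (D : Set H)) : (formOperator D Q).graph = formGraph D Q := by
  refine Submodule.toLinearPMap_graph_eq _ ?_
  rintro ⟨a, v⟩ ⟨u, hu, hu'⟩ (rfl : a = 0)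
  have hu0 : u = 0 := Subtype.ext hu
  subst hu0
  refine hD.eq_zero_of_inner_left (𝕜 := ℝ) fun w hw => ?_
  have := hu' ⟨w, hw⟩
  simpa using this.symm

end FormOperator

/-! ### The logarithmic Dirichlet form and Laplacian of a metric measure space -/

section LogForm

variable {X : Type*} [MetricSpace X] [SecondCountableTopology X] [MeasurableSpace X]
  [BorelSpace X]

/-- The integrand `(f(x) - f(y)) (g(x) - g(y)) / d(x, y) ^ δ`; on the diagonal, which does not
contribute, it is zero. -/
def kernel (δ : ℝ) (f g : X → ℝ) (z : X × X) : ℝ :=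
  (f z.1 - f z.2) * (g z.1 - g z.2) / dist z.1 z.2 ^ δ

variable (μ : Measure X) [IsFiniteMeasure μ] (δ : ℝ)

theorem aestronglyMeasurable_kernel (f g : Lp ℝ 2 μ) :
    AEStronglyMeasurable (kernel δ f g) (μ.prod μ) := by
  have hf := Lp.aestronglyMeasurable f
  have hg := Lp.aestronglyMeasurable g
  have hd : Measurable fun z : X × X => (dist z.1 z.2 ^ δ)⁻¹ := by fun_prop
  exact (((hf.comp_fst (ν := μ)).sub (hf.comp_snd (μ := μ))).mul
      ((hg.comp_fst (ν := μ)).sub (hg.comp_snd (μ := μ)))).mul hd.aestronglyMeasurable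

theorem kernel_congr {f f' g g' : X → ℝ} (hf : f =ᵐ[μ] f') (hg : g =ᵐ[μ] g') :
    kernel δ f g =ᵐ[μ.prod μ] kernel δ f' g' := by
  have h1 := Measure.quasiMeasurePreserving_fst (μ := μ) (ν := μ)
  have h2 := Measure.quasiMeasurePreserving_snd (μ := μ) (ν := μ)
  filter_upwards [h1.ae hf, h2.ae hf, h1.ae hg, h2.ae hg] with z a b c d
  simp only [kernel, a, b, c, d]

theorem kernel_add_ae (f g h : Lp ℝ 2 μ) :
    kernel δ (f + g : Lp ℝ 2 μ) h =ᵐ[μ.prod μ] kernel δ f h + kernel δ g h := by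
  refine (kernel_congr μ δ (Lp.coeFn_add f g) (EventuallyEq.refl _ _)).trans (.of_eq ?_)
  ext z
  simp only [kernel, Pi.add_apply]
  ring

theorem kernel_smul_ae (c : ℝ) (f h : Lp ℝ 2 μ) :
    kernel δ (c • f : Lp ℝ 2 μ) h =ᵐ[μ.prod μ] c • kernel δ f h := by
  refine (kernel_congr μ δ (Lp.coeFn_smul c f) (EventuallyEq.refl _ _)).trans (.of_eq ?_)
  ext z
  simp only [kernel, Pi.smul_apply, smul_eq_mul]
  ring

theorem kernel_comm (f g : X → ℝ) : kernel δ f g = kernel δ g f := by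
  ext z
  simp only [kernel, mul_comm]

theorem integrable_kernel {f g : Lp ℝ 2 μ} (hf : Integrable (kernel δ f f) (μ.prod μ))
    (hg : Integrable (kernel δ g g) (μ.prod μ)) : Integrable (kernel δ f g) (μ.prod μ) := by
  refine (hf.add hg).mono' (aestronglyMeasurable_kernel μ δ f g) (.of_forall fun z => ?_)
  have hc : 0 ≤ dist z.1 z.2 ^ δ := by positivity
  simp only [kernel, Pi.add_apply, Real.norm_eq_abs, abs_div, abs_of_nonneg hc, ← add_div]
  gcongr
  rw [abs_le]
  constructor <;> nlinarith [sq_nonneg ((f z.1 - f z.2) + (g z.1 - g z.2)),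
    sq_nonneg ((f z.1 - f z.2) - (g z.1 - g z.2)), sq_nonneg (f z.1 - f z.2),
    sq_nonneg (g z.1 - g z.2)]

/-- `Dom 𝓔`: the `f ∈ L²(X, μ)` with `∬ |f(x) - f(y)|² / d(x, y) ^ δ dμ(y) dμ(x) < ∞`. (The
integrand is nonnegative and measurable, so this is integrability on the product.) -/
def formDomain : Submodule ℝ (Lp ℝ 2 μ) where
  carrier := {f | Integrable (kernel δ f f) (μ.prod μ)}
  add_mem' := by
    intro f g hf hg
    have hfg := integrable_kernel μ δ hf hg
    have h : kernel δ (f + g : Lp ℝ 2 μ) (f + g : Lp ℝ 2 μ) =ᵐ[μ.prod μ]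
        kernel δ f f + kernel δ f g + kernel δ f g + kernel δ g g := by
      refine (kernel_congr μ δ (Lp.coeFn_add f g) (Lp.coeFn_add f g)).trans (.of_eq ?_)
      ext z
      simp only [kernel, Pi.add_apply]
      ring
    exact (((hf.add hfg).add hfg).add hg).congr h.symm
  zero_mem' := by
    have h : kernel δ (0 : Lp ℝ 2 μ) (0 : Lp ℝ 2 μ) =ᵐ[μ.prod μ] fun _ => (0 : ℝ) := by
      refine (kernel_congr μ δ (Lp.coeFn_zero ℝ 2 μ) (Lp.coeFn_zero ℝ 2 μ)).trans (.of_eq ?_)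
      ext z
      simp [kernel]
    exact (integrable_zero _ _ _).congr h.symm
  smul_mem' := by
    intro c f hf
    have h : kernel δ (c • f : Lp ℝ 2 μ) (c • f : Lp ℝ 2 μ) =ᵐ[μ.prod μ]
        (c * c) • kernel δ f f := by
      refine (kernel_congr μ δ (Lp.coeFn_smul c f) (Lp.coeFn_smul c f)).trans (.of_eq ?_)
      ext z
      simp only [kernel, Pi.smul_apply, smul_eq_mul]
      ring
    exact (Integrable.smul (c * c) hf).congr h.symm

theorem mem_formDomain {f : Lp ℝ 2 μ} :
    f ∈ formDomain μ δ ↔ Integrable (kernel δ f f) (μ.prod μ) := Iff.rfl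

/-- The logarithmic Dirichlet form
`𝓔(f, g) = 1/2 ∬ (f(x) - f(y)) (g(x) - g(y)) / d(x, y) ^ δ dμ(y) dμ(x)` on `Dom 𝓔`. -/
def logForm : formDomain μ δ →ₗ[ℝ] formDomain μ δ →ₗ[ℝ] ℝ :=
  LinearMap.mk₂ ℝ (fun f g => 1 / 2 * ∫ z, kernel δ f.1 g.1 z ∂(μ.prod μ))
    (by
      intro f f' g
      rw [← mul_add, Submodule.coe_add, integral_congr_ae (kernel_add_ae μ δ f.1 f'.1 g.1),
        integral_add' (integrable_kernel μ δ f.2 g.2) (integrable_kernel μ δ f'.2 g.2)])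
    (by
      intro c f g
      rw [Submodule.coe_smul, integral_congr_ae (kernel_smul_ae μ δ c f.1 g.1)]
      simp only [Pi.smul_apply, smul_eq_mul, integral_const_mul]
      ring)
    (by
      intro f g g'
      simp only [kernel_comm δ (f.1 : X → ℝ)]
      rw [← mul_add, Submodule.coe_add, integral_congr_ae (kernel_add_ae μ δ g.1 g'.1 f.1),
        integral_add' (integrable_kernel μ δ g.2 f.2) (integrable_kernel μ δ g'.2 f.2)])
    (by
      intro c f g
      simp only [kernel_comm δ (f.1 : X → ℝ)]
      rw [Submodule.coe_smul, integral_congr_ae (kernel_smul_ae μ δ c g.1 f.1)]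
      simp only [Pi.smul_apply, smul_eq_mul, integral_const_mul]
      ring)

/-- The logarithmic Dirichlet Laplacian `Δ` of an Ahlfors `δ`-regular space `(X, d, μ)`: the
operator in `L²(X, μ)` associated to the form `𝓔`. -/
def logLaplacian : Lp ℝ 2 μ →ₗ.[ℝ] Lp ℝ 2 μ :=
  formOperator (formDomain μ δ) (logForm μ δ)

/-- The (classes of) Lipschitz functions in `L²(X, μ)`. -/
def lipschitzSubmodule : Submodule ℝ (Lp ℝ 2 μ) where
  carrier := {f | ∃ (φ : X → ℝ) (K : ℝ≥0), LipschitzWith K φ ∧ f =ᵐ[μ] φ}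
  add_mem' := by
    rintro f g ⟨φ, K, hφ, hf⟩ ⟨ψ, L, hψ, hg⟩
    exact ⟨φ + ψ, K + L, hφ.add hψ, (Lp.coeFn_add f g).trans (hf.add hg)⟩
  zero_mem' := ⟨fun _ => 0, 0, LipschitzWith.const 0, Lp.coeFn_zero ℝ 2 μ⟩
  smul_mem' := by
    rintro c f ⟨φ, K, hφ, hf⟩
    exact ⟨c • φ, ‖c‖₊ * K, (lipschitzWith_smul c).comp hφ,
      (Lp.coeFn_smul c f).trans (hf.const_smul c)⟩

end LogForm

/-! ### The heat semigroup and trace class operators -/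

section Semigroup

variable {H : Type*} [NormedAddCommGroup H] [InnerProductSpace ℝ H]

/-- `T t = e^{-tA}` for `t ≥ 0`: `T` is a strongly continuous one-parameter semigroup of bounded
operators whose infinitesimal generator is `-A`, domains included. -/
structure IsSemigroupOf (A : H →ₗ.[ℝ] H) (T : ℝ≥0 → H →L[ℝ] H) : Prop where
  zero : T 0 = 1
  add : ∀ s t, T (s + t) = T s * T t
  continuous : ∀ f, Continuous fun t => T t f
  generator : ∀ f g : H, (f, g) ∈ A.graph ↔
    Tendsto (fun t : ℝ≥0 => (t : ℝ)⁻¹ • (f - T t f)) (𝓝[>] 0) (𝓝 g)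

end Semigroup

/-- `T` is trace class: its absolute value `P = |T|`, the positive operator with
`P² = T† T`, has finite trace `∑ ⟪e i, P (e i)⟫` in every Hilbert basis `e`. -/
def IsTraceClass.{u} {H : Type u} [NormedAddCommGroup H] [InnerProductSpace ℝ H]
    [CompleteSpace H] (T : H →L[ℝ] H) : Prop :=
  ∃ P : H →L[ℝ] H, P.IsPositive ∧ P * P = ContinuousLinearMap.adjoint T * T ∧
    ∀ (ι : Type u) (e : HilbertBasis ι ℝ H), Summable fun i => inner ℝ (e i) (P (e i))

/-! ### The interval `[-1, 1]` and the Legendre polynomials -/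

/-- The interval `[-1, 1]` with the Euclidean metric. -/
abbrev Interval : Type := Set.Icc (-1 : ℝ) 1

/-- Lebesgue measure on `[-1, 1]`. -/
abbrev lebesgue : Measure Interval := (volume : Measure ℝ).comap Subtype.val

instance : IsFiniteMeasure lebesgue :=
  ⟨by
    rw [Measure.comap_apply Subtype.val Subtype.val_injective
      (fun s hs => measurableSet_Icc.subtype_image hs) _ MeasurableSet.univ,
      Set.image_univ, Subtype.range_coe]
    exact measure_Icc_lt_top⟩

/-- The real Hilbert space `L²([-1, 1])`. -/
abbrev L2Interval : Type := Lp ℝ 2 lebesgue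

/-- The Legendre polynomials, by Rodrigues' formula `(2ⁿ n!)⁻¹ (d/dx)ⁿ (x² - 1)ⁿ`. -/
def legendre (n : ℕ) : Polynomial ℝ :=
  ((2 : ℝ) ^ n * n.factorial)⁻¹ • (Polynomial.derivative^[n] ((Polynomial.X ^ 2 - 1) ^ n))

/-- The Legendre polynomial `pₙ` as an element of `L²([-1, 1])`. -/
def legendreLp (n : ℕ) : L2Interval :=
  ContinuousMap.toLp 2 lebesgue ℝ ((legendre n).toContinuousMapOn (Set.Icc (-1 : ℝ) 1))

/-- The logarithmic Dirichlet Laplacian of `[-1, 1]`, a space of dimension `δ = 1`. -/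
def intervalLaplacian : L2Interval →ₗ.[ℝ] L2Interval :=
  logLaplacian lebesgue 1

end LogLaplacian

end

open LogLaplacian

noncomputable section

namespace LogLaplacian

/-! ### Diagonal operators -/

section Diagonal

variable {H : Type*} [NormedAddCommGroup H] [InnerProductSpace ℝ H] [CompleteSpace H]
  (e : HilbertBasis ℕ ℝ H)

/-! The operator respects the degree filtration on polynomials. For a Lipschitz function the kernel
is bounded, so `Δ φ (x) = ∫ (φ x - φ y) / |x - y| dy`. For `x ^ n` this integral is `2 h_n x ^ n`
plus terms of lower degree (`integral_pow_sub_pow_div`). Since `p_n` is orthogonal to all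
polynomials of degree below `n` and the form is symmetric, the lower-order remainder vanishes on
`p_n`, so `Δ p_n = 2 h_n p_n` (`polyLp_lapPoly_legendre`).

Polynomials are dense in `L²`, so the normalized `p_n` form a Hilbert basis. Because the form is
closed, `Δ` is the maximal operator that is diagonal in this basis (`isDiagonalPMap_formOperator`).
The remaining claims are read off from the eigenvalues. Eigenfunction expansions converge in the
graph norm, and the `p_n` are Lipschitz, which gives the core (`IsDiagonalPMap.hasCore`). Any
semigroup of `Δ` must multiply `p_n` by `exp (-2 h_n t)`, and these multipliers do define a
semigroup (`IsDiagonalPMap.existsUnique_semigroup`). It is compact for `t > 0` because `h_n → ∞`. It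
is trace class exactly when `∑ exp (-2 t h_n)` converges; as `h_n = log n + O(1)`, this is the
convergence of `∑ n ^ (-2 t)`. -/

include e in
theorem hilbertBasis_ext {f g : H} (h : ∀ n, inner ℝ (e n) f = inner ℝ (e n) g) : f = g := by
  apply e.repr.injective
  ext n
  simpa [e.repr_apply_apply] using h n

theorem hasSum_sq_inner (f : H) : HasSum (fun n => inner ℝ (e n) f ^ 2) (‖f‖ ^ 2) := by
  have h := e.hasSum_inner_mul_inner f f
  rw [real_inner_self_eq_norm_sq] at h
  refine (congrArg (HasSum · _) (funext fun n => ?_)).mp h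
  rw [real_inner_comm f (e n), sq]

theorem exists_inner_eq {a : ℕ → ℝ} (ha : Summable fun n => a n ^ 2) :
    ∃ f : H, ∀ n, inner ℝ (e n) f = a n := by
  have hm : Memℓp a 2 := by
    rw [memℓp_gen_iff (by norm_num)]
    simpa using ha
  refine ⟨e.repr.symm ⟨a, hm⟩, fun n => ?_⟩
  rw [← e.repr_apply_apply]
  simp

theorem exists_diagonal {c : ℕ → ℝ} {C : ℝ} (hC : 0 ≤ C) (hc : ∀ n, |c n| ≤ C) :
    ∃ T : H →L[ℝ] H, ‖T‖ ≤ C ∧ ∀ f n, inner ℝ (e n) (T f) = c n * inner ℝ (e n) f := by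
  have hle : ∀ f n, (c n * inner ℝ (e n) f) ^ 2 ≤ C ^ 2 * inner ℝ (e n) f ^ 2 := fun f n => by
    rw [mul_pow]
    refine mul_le_mul_of_nonneg_right ?_ (sq_nonneg _)
    exact sq_le_sq' (neg_le_of_abs_le (hc n)) (le_of_abs_le (hc n))
  have hs : ∀ f, Summable fun n => (c n * inner ℝ (e n) f) ^ 2 := fun f =>
    .of_nonneg_of_le (fun n => sq_nonneg _) (hle f) ((hasSum_sq_inner e f).summable.mul_left _)
  choose T hT using fun f => exists_inner_eq e (hs f)
  let L : H →ₗ[ℝ] H :=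
    { toFun := T
      map_add' := fun f g => hilbertBasis_ext e fun n => by
        simp only [hT, inner_add_right, mul_add]
      map_smul' := fun r f => hilbertBasis_ext e fun n => by
        simp only [hT, inner_smul_right, RingHom.id_apply]
        ring }
  have hb : ∀ f, ‖L f‖ ≤ C * ‖f‖ := fun f => by
    refine abs_le_of_sq_le_sq' ?_ (by positivity) |>.2
    rw [mul_pow]
    refine hasSum_le (fun n => ?_) (hasSum_sq_inner e (L f)) ((hasSum_sq_inner e f).mul_left _)
    change inner ℝ (e n) (T f) ^ 2 ≤ _
    rw [hT]
    exact hle f n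
  exact ⟨L.mkContinuous C hb, L.mkContinuous_norm_le hC hb, fun f n => hT f n⟩

/-- `T` acts on the Hilbert basis `e` as multiplication by `c`. -/
def IsDiagonal (c : ℕ → ℝ) (T : H →L[ℝ] H) : Prop :=
  ∀ f n, inner ℝ (e n) (T f) = c n * inner ℝ (e n) f

variable {e}

theorem IsDiagonal.unique {c : ℕ → ℝ} {S T : H →L[ℝ] H} (hS : IsDiagonal e c S)
    (hT : IsDiagonal e c T) : S = T :=
  ContinuousLinearMap.ext fun f => hilbertBasis_ext e fun n => by rw [hS, hT]

theorem IsDiagonal.norm_le {c : ℕ → ℝ} {C : ℝ} {T : H →L[ℝ] H} (hT : IsDiagonal e c T)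
    (hC : 0 ≤ C) (hc : ∀ n, |c n| ≤ C) : ‖T‖ ≤ C := by
  obtain ⟨S, hS, hS'⟩ := exists_diagonal e hC hc
  exact hT.unique (S := T) (T := S) hS' ▸ hS

theorem IsDiagonal.mul {c d : ℕ → ℝ} {S T : H →L[ℝ] H} (hS : IsDiagonal e c S)
    (hT : IsDiagonal e d T) : IsDiagonal e (fun n => c n * d n) (S * T) := fun f n => by
  rw [mul_apply_eq_comp, hS, hT, mul_assoc]

theorem isDiagonal_one : IsDiagonal e (fun _ => 1) (1 : H →L[ℝ] H) := fun f n => by simp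

theorem inner_basis (m n : ℕ) : inner ℝ (e m) (e n) = if m = n then 1 else 0 := by
  classical
  exact orthonormal_iff_ite.mp e.orthonormal m n

theorem IsDiagonal.apply_basis {c : ℕ → ℝ} {T : H →L[ℝ] H} (hT : IsDiagonal e c T) (n : ℕ) :
    T (e n) = c n • e n := hilbertBasis_ext e fun m => by
  rw [hT, inner_smul_right, inner_basis]
  split_ifs with h
  · rw [h]
  · simp

theorem IsDiagonal.of_apply_basis {c : ℕ → ℝ} {C : ℝ} {T : H →L[ℝ] H} (hc : ∀ n, |c n| ≤ C)
    (hT : ∀ n, T (e n) = c n • e n) : IsDiagonal e c T := by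
  obtain ⟨S, -, hS⟩ := exists_diagonal e ((abs_nonneg _).trans (hc 0)) hc
  suffices T = S from this ▸ hS
  refine ContinuousLinearMap.ext_on (s := Set.range e) ?_ ?_
  · exact Submodule.dense_iff_topologicalClosure_eq_top.2 e.dense_span
  · rintro _ ⟨n, rfl⟩
    rw [hT, IsDiagonal.apply_basis (e := e) hS]

theorem IsDiagonal.inner_hasSum {c : ℕ → ℝ} {T : H →L[ℝ] H} (hT : IsDiagonal e c T) (f g : H) :
    HasSum (fun n => c n * (inner ℝ (e n) f * inner ℝ (e n) g)) (inner ℝ f (T g)) := by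
  refine (congrArg (HasSum · _) (funext fun n => ?_)).mp (e.hasSum_inner_mul_inner f (T g))
  rw [hT, real_inner_comm f (e n)]
  ring

theorem IsDiagonal.isSymmetric {c : ℕ → ℝ} {T : H →L[ℝ] H} (hT : IsDiagonal e c T) :
    (T : H →ₗ[ℝ] H).IsSymmetric := fun f g => by
  simp only [ContinuousLinearMap.coe_coe]
  rw [real_inner_comm]
  refine (hT.inner_hasSum g f).unique ?_
  refine (congrArg (HasSum · _) (funext fun n => ?_)).mp (hT.inner_hasSum f g)
  ring

theorem IsDiagonal.isPositive {c : ℕ → ℝ} {T : H →L[ℝ] H} (hT : IsDiagonal e c T)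
    (hc : ∀ n, 0 ≤ c n) : T.IsPositive := by
  refine ⟨hT.isSymmetric, fun f => ?_⟩
  rw [ContinuousLinearMap.reApplyInnerSelf_apply, RCLike.re_to_real, real_inner_comm]
  refine (hT.inner_hasSum f f).nonneg fun n => ?_
  exact mul_nonneg (hc n) (mul_self_nonneg _)

/-- Bounded diagonal operators with pointwise convergent coefficients converge strongly. -/
theorem IsDiagonal.tendsto {α : Type*} {l : Filter α} {c : α → ℕ → ℝ} {d : ℕ → ℝ}
    {T : α → H →L[ℝ] H} {S : H →L[ℝ] H} (hT : ∀ a, IsDiagonal e (c a) (T a))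
    (hS : IsDiagonal e d S) (hc : ∀ a n, |c a n| ≤ 1) (hd : ∀ n, |d n| ≤ 1)
    (hlim : ∀ n, Tendsto (fun a => c a n) l (𝓝 (d n))) (f : H) :
    Tendsto (fun a => T a f) l (𝓝 (S f)) := by
  have h : ∀ a, ‖T a f - S f‖ ^ 2 = ∑' n, ((c a n - d n) * inner ℝ (e n) f) ^ 2 := fun a => by
    rw [← (hasSum_sq_inner e (T a f - S f)).tsum_eq]
    congr 1 with n
    rw [inner_sub_right, hT, hS, sub_mul]
  have h0 : Tendsto (fun a => ‖T a f - S f‖ ^ 2) l (𝓝 0) := by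
    simp only [h]
    rw [← tsum_zero (β := ℕ)]
    refine tendsto_tsum_of_dominated_convergence (bound := fun n => 2 ^ 2 * inner ℝ (e n) f ^ 2)
      ((hasSum_sq_inner e f).summable.mul_left _) (fun n => ?_) (.of_forall fun a n => ?_)
    · have := (((hlim n).sub_const (d n)).mul_const (inner ℝ (e n) f)).pow 2
      simpa using this
    · rw [Real.norm_eq_abs, abs_of_nonneg (sq_nonneg _), mul_pow]
      refine mul_le_mul_of_nonneg_right ?_ (sq_nonneg _)
      have h1 := abs_le.1 (hc a n)
      have h2 := abs_le.1 (hd n)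
      exact sq_le_sq' (by linarith) (by linarith)
  rw [tendsto_iff_norm_sub_tendsto_zero]
  simpa [Real.sqrt_sq] using h0.sqrt

/-- The finite-rank truncations `F N` converge to `T` in operator norm, the error being the supremum
of the tail of `|c|`. -/
theorem IsDiagonal.isCompactOperator {c : ℕ → ℝ} {T : H →L[ℝ] H} (hT : IsDiagonal e c T)
    (hc : Tendsto c atTop (𝓝 0)) : IsCompactOperator T := by
  let F : ℕ → H →L[ℝ] H := fun N =>
    ∑ n ∈ Finset.range N, c n • (innerSL ℝ (e n)).smulRight (e n)
  have hF : ∀ N, IsDiagonal e (fun n => if n < N then c n else 0) (F N) := fun N f n => by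
    simp only [F, sum_apply, inner_sum]
    simp [inner_smul_right, inner_basis, Finset.sum_ite_eq]
  have hlim : Tendsto F atTop (𝓝 T) := by
    rw [Metric.tendsto_atTop]
    intro ε hε
    obtain ⟨N, hN⟩ := Metric.tendsto_atTop.1 hc (ε / 2) (by positivity)
    refine ⟨N, fun M hM => ?_⟩
    rw [dist_eq_norm]
    have hD : IsDiagonal e (fun n => if n < M then 0 else - c n) (F M - T) := fun f n => by
      rw [sub_apply, inner_sub_right, hF, hT]
      dsimp only
      split_ifs <;> ring
    refine (hD.norm_le (C := ε / 2) (by positivity) fun n => ?_).trans_lt (by linarith)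
    split_ifs with h
    · simp; positivity
    · have := hN n (by omega)
      rw [Real.dist_eq, sub_zero] at this
      rw [abs_neg]
      exact this.le
  refine isCompactOperator_of_tendsto hlim (.of_forall fun N => ?_)
  have : F N ∈ compactOperator (RingHom.id ℝ) H H := by
    refine Submodule.sum_mem _ fun n _ => Submodule.smul_mem _ _ ?_
    change IsCompactOperator _
    have h1 : IsCompactOperator (innerSL ℝ (e n)) := by
      exact isCompactOperator_of_locallyCompactSpace_dom (innerSL ℝ (e n))
    exact h1.clm_comp ((1 : ℝ →L[ℝ] ℝ).smulRight (e n))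
  exact this

end Diagonal

section Trace

universe u
variable {H : Type u} [NormedAddCommGroup H] [InnerProductSpace ℝ H] [CompleteSpace H]
  {e : HilbertBasis ℕ ℝ H}

theorem IsDiagonal.adjoint_mul_self {c : ℕ → ℝ} {T : H →L[ℝ] H} (hT : IsDiagonal e c T) :
    ContinuousLinearMap.adjoint T * T = T * T := by
  have := (ContinuousLinearMap.isSelfAdjoint_iff_isSymmetric.2 hT.isSymmetric)
  rw [ContinuousLinearMap.isSelfAdjoint_iff'] at this
  rw [this]

/-- Here `T` is its own absolute value. Expanding each `⟪b i, T (b i)⟫` in the basis `e` and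
exchanging sums, the weight of `c n` is `∑ ⟪e n, b i⟫²`, at most `1` by Bessel, so `∑ c n` bounds
all partial sums in any basis. -/
theorem IsDiagonal.isTraceClass {c : ℕ → ℝ} {T : H →L[ℝ] H} (hT : IsDiagonal e c T)
    (hc : ∀ n, 0 ≤ c n) (hs : Summable c) : IsTraceClass T := by
  refine ⟨T, hT.isPositive hc, hT.adjoint_mul_self.symm, fun ι b => ?_⟩
  refine summable_of_sum_le (c := ∑' n, c n) (fun i => ?_) fun s => ?_
  · exact (hT.inner_hasSum _ _).nonneg fun n => mul_nonneg (hc n) (mul_self_nonneg _)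
  · refine hasSum_le (fun n => ?_) (hasSum_sum fun i (_ : i ∈ s) => hT.inner_hasSum (b i) (b i))
      hs.hasSum
    rw [← Finset.mul_sum]
    refine mul_le_of_le_one_right (hc n) ?_
    have h := b.orthonormal.sum_inner_products_le (s := s) (e n)
    rw [e.orthonormal.1 n, one_pow] at h
    refine le_trans (le_of_eq (Finset.sum_congr rfl fun i _ => ?_)) h
    rw [real_inner_comm, Real.norm_eq_abs, sq_abs, sq]

/-- A positive operator whose square has eigenvalue `a ^ 2`, `0 < a`, has eigenvalue `a`. -/
theorem eq_smul_of_mul_self {P : H →L[ℝ] H} (hP : P.IsPositive) {a : ℝ} (ha : 0 < a) {x : H}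
    (hx : P (P x) = a ^ 2 • x) : P x = a • x := by
  -- The factorization `(P + a)(P - a) x = 0` gives `P q = -a q`, which contradicts positivity
  -- unless `q = 0`.
  set q := P x - a • x with hq
  have h1 : P q = -(a • q) := by
    rw [hq, map_sub, map_smul, hx]
    module
  have h2 : 0 ≤ inner ℝ (P q) q := by
    simpa [ContinuousLinearMap.reApplyInnerSelf_apply] using hP.2 q
  rw [h1, inner_neg_left, real_inner_smul_left, real_inner_self_eq_norm_sq] at h2
  have h3 : ‖q‖ ^ 2 ≤ 0 := by
    by_contra! h
    nlinarith [mul_pos ha h]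
  have h4 : q = 0 := by
    rw [← norm_eq_zero]
    exact pow_eq_zero_iff two_ne_zero |>.1 (le_antisymm h3 (by positivity))
  exact sub_eq_zero.1 h4

/-- From `P² = T²` and `0 < c n` it follows that `P` has the same eigenvalues as `T` on `e`, so its
trace in this basis is `∑ c n`. -/
theorem IsDiagonal.summable_of_isTraceClass {c : ℕ → ℝ} {T : H →L[ℝ] H} (hT : IsDiagonal e c T)
    (hc : ∀ n, 0 < c n) (h : IsTraceClass T) : Summable c := by
  obtain ⟨P, hP, hPT, hs⟩ := h
  rw [hT.adjoint_mul_self] at hPT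
  have hPe : ∀ n, P (e n) = c n • e n := fun n => by
    refine eq_smul_of_mul_self hP (hc n) ?_
    have := congrArg (fun A : H →L[ℝ] H => A (e n)) hPT
    simp only [mul_apply_eq_comp, hT.apply_basis, map_smul] at this
    rw [this, smul_smul, sq]
  -- `IsTraceClass` tests bases indexed in the universe of `H`, so `e` is lifted there.
  let b : HilbertBasis (ULift.{u} ℕ) ℝ H := HilbertBasis.mk (v := fun i => e i.down)
    (e.orthonormal.comp _ ULift.down_injective) (by
      have : Set.range (fun i : ULift.{u} ℕ => e i.down) = Set.range e :=
        ULift.down_surjective.range_comp e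
      rw [this, e.dense_span])
  have := hs _ b
  refine (Equiv.ulift.symm.summable_iff.2 this).congr fun n => ?_
  simp [b, hPe, inner_smul_right, e.orthonormal.1 n]

end Trace

/-! ### Self-adjoint operators with an eigenbasis and their semigroups -/

section DiagonalGenerator

variable {H : Type*} [NormedAddCommGroup H] [InnerProductSpace ℝ H] [CompleteSpace H]
  (e : HilbertBasis ℕ ℝ H)

/-- `A` is the maximal operator with `A (e n) = l n • e n`. -/
def IsDiagonalPMap (l : ℕ → ℝ) (A : H →ₗ.[ℝ] H) : Prop :=
  ∀ f g : H, (f, g) ∈ A.graph ↔ ∀ n, inner ℝ (e n) g = l n * inner ℝ (e n) f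

variable {e} {l : ℕ → ℝ} {A : H →ₗ.[ℝ] H}

theorem IsDiagonalPMap.basis_mem (hA : IsDiagonalPMap e l A) (n : ℕ) :
    (e n, l n • e n) ∈ A.graph := by
  rw [hA]
  intro m
  rw [inner_smul_right, inner_basis]
  split_ifs with h
  · rw [h]
  · simp

theorem IsDiagonalPMap.isClosed (hA : IsDiagonalPMap e l A) : A.IsClosed := by
  have : (A.graph : Set (H × H)) =
      ⋂ n, {p | inner ℝ (e n) p.2 = l n * inner ℝ (e n) p.1} := by
    ext ⟨f, g⟩
    simpa using hA f g
  rw [LinearPMap.IsClosed, this]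
  exact isClosed_iInter fun n => isClosed_eq (by fun_prop) (by fun_prop)

/-- Every `(f, g)` in the graph is the sum of the series `∑ ⟪e n, f⟫ • (e n, l n • e n)`, whose
partial sums lie in the graph of the restriction. -/
theorem IsDiagonalPMap.hasCore (hA : IsDiagonalPMap e l A) {S : Submodule ℝ H}
    (hS : S ≤ A.domain) (he : ∀ n, e n ∈ S) : A.HasCore S := by
  refine ⟨hS, ?_⟩
  have hle : A.domRestrict S ≤ A := A.domRestrict_le
  have hcl : (A.domRestrict S).IsClosable := hA.isClosed.isClosable.leIsClosable hle
  have hA' : A.graph.topologicalClosure = A.graph :=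
    IsClosed.submodule_topologicalClosure_eq hA.isClosed
  refine LinearPMap.eq_of_eq_graph ?_
  rw [← hcl.graph_closure_eq_closure_graph]
  refine le_antisymm ?_ ?_
  · rw [← hA']
    exact Submodule.topologicalClosure_mono (LinearPMap.le_graph_of_le hle)
  rintro ⟨f, g⟩ hfg
  have hmem : ∀ n, (e n, l n • e n) ∈ (A.domRestrict S).graph := fun n => by
    have h := hA.basis_mem n
    rw [LinearPMap.mem_graph_iff] at h ⊢
    obtain ⟨y, hy, hy'⟩ := h
    simp only at hy hy'
    refine ⟨⟨e n, he n, hy ▸ y.2⟩, rfl, ?_⟩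
    rw [← hy']
    exact hle.2 (by simp [hy])
  have hf := e.hasSum_repr f
  have hg := e.hasSum_repr g
  simp only [e.repr_apply_apply] at hf hg
  have hfg' : HasSum (fun n => inner ℝ (e n) f • (e n, l n • e n)) (f, g) := by
    refine (congrArg (HasSum · _) (funext fun n => ?_)).mp (hf.prodMk hg)
    rw [(hA f g).1 hfg n, Prod.smul_mk, smul_smul, mul_comm]
  refine (A.domRestrict S).graph.isClosed_topologicalClosure.mem_of_tendsto hfg'
    (.of_forall fun s => ?_)
  exact Submodule.le_topologicalClosure _
    (Submodule.sum_mem _ fun n _ => Submodule.smul_mem _ _ (hmem n))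

theorem tendsto_toNNReal_sub (x : ℝ) :
    Tendsto (fun y => (y - x).toNNReal) (𝓝[>] x) (𝓝[>] 0) := by
  refine tendsto_nhdsWithin_iff.2 ⟨?_, ?_⟩
  · have h : Continuous fun y => (y - x).toNNReal := by fun_prop
    simpa using (h.tendsto x).mono_left nhdsWithin_le_nhds
  · filter_upwards [self_mem_nhdsWithin] with y hy
    simpa using hy

theorem tendsto_one_sub_exp_div (a : ℝ) :
    Tendsto (fun t : ℝ≥0 => (t : ℝ)⁻¹ * (1 - Real.exp (-(t * a)))) (𝓝[>] 0) (𝓝 a) := by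
  have h1 : HasDerivAt (fun s : ℝ => Real.exp (-(s * a))) (-a) 0 := by
    simpa using ((hasDerivAt_id (0 : ℝ)).mul_const a).neg.exp
  have h2 : Tendsto (fun t : ℝ≥0 => (t : ℝ)) (𝓝[>] 0) (𝓝[>] 0) := by
    refine tendsto_nhdsWithin_iff.2 ⟨?_, ?_⟩
    · simpa using (NNReal.continuous_coe.tendsto 0).mono_left nhdsWithin_le_nhds
    · filter_upwards [self_mem_nhdsWithin] with y hy
      simpa using hy
  have h3 := (h1.tendsto_slope_zero_right.comp h2).neg
  rw [neg_neg] at h3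
  refine h3.congr fun t => ?_
  simp only [Function.comp, zero_add, zero_mul, neg_zero, Real.exp_zero, smul_eq_mul]
  ring

/-- The orbit solves `v' = -a v` in the sense of right derivatives, which is all that the generator
provides. With the integrating factor, `exp (s a) • v s` is continuous with zero right derivative,
hence constant. -/
theorem IsSemigroupOf.apply_eigenvector {T : ℝ≥0 → H →L[ℝ] H} (hT : IsSemigroupOf A T) {f : H}
    {a : ℝ} (hf : (f, a • f) ∈ A.graph) (t : ℝ≥0) : T t f = Real.exp (-(t * a)) • f := by
  let v : ℝ → H := fun s => T s.toNNReal f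
  have hv : Continuous v := (hT.continuous f).comp continuous_real_toNNReal
  have hv' : ∀ x, 0 ≤ x → HasDerivWithinAt v (-(a • v x)) (Set.Ici x) x := fun x hx => by
    rw [← hasDerivWithinAt_Ioi_iff_Ici, hasDerivWithinAt_iff_tendsto_slope' (by simp)]
    have h1 := (((hT.generator _ _).1 hf).comp (tendsto_toNNReal_sub x))
    have h2 := (((T x.toNNReal).continuous.tendsto _).comp h1).neg
    rw [map_smul] at h2
    refine h2.congr' ?_
    filter_upwards [self_mem_nhdsWithin] with y (hy : x < y)
    have hxy : y.toNNReal = x.toNNReal + (y - x).toNNReal := by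
      rw [← Real.toNNReal_add hx (by linarith)]
      congr 1
      ring
    simp only [Function.comp, slope_def_module, v]
    rw [hxy, hT.add, Real.coe_toNNReal _ (by linarith : 0 ≤ y - x), mul_apply_eq_comp, map_smul,
      map_sub, ← smul_neg, neg_sub]
  let w : ℝ → H := fun s => Real.exp (s * a) • v s
  have hw : ∀ x ∈ Set.Ico (0 : ℝ) t, HasDerivWithinAt w 0 (Set.Ici x) x := fun x hx => by
    have h1 : HasDerivAt (fun s : ℝ => Real.exp (s * a)) (Real.exp (x * a) * a) x := by
      simpa using ((hasDerivAt_id x).mul_const a).exp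
    refine (h1.hasDerivWithinAt.smul (hv' x hx.1)).congr_deriv ?_
    module
  have hc := constant_of_has_deriv_right_zero (f := w) (a := 0) (b := t)
    (Continuous.continuousOn (by fun_prop)) hw t ⟨t.2, le_rfl⟩
  simp only [w, v, Real.toNNReal_coe, zero_mul, Real.exp_zero, one_smul, Real.toNNReal_zero,
    hT.zero, one_apply_eq_self] at hc
  conv_rhs => rw [Real.exp_neg, ← hc, smul_smul, inv_mul_cancel₀ (Real.exp_ne_zero _), one_smul]

theorem IsDiagonalPMap.isDiagonal (hA : IsDiagonalPMap e l A) (hl : ∀ n, 0 ≤ l n)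
    {T : ℝ≥0 → H →L[ℝ] H} (hT : IsSemigroupOf A T) (t : ℝ≥0) :
    IsDiagonal e (fun n => Real.exp (-(t * l n))) (T t) := by
  refine IsDiagonal.of_apply_basis (C := 1) (fun n => ?_) fun n =>
    hT.apply_eigenvector (hA.basis_mem n) t
  have := mul_nonneg t.2 (hl n)
  rw [Real.abs_exp, Real.exp_le_one_iff]
  exact neg_nonpos.2 this

theorem IsDiagonalPMap.existsUnique_semigroup (hA : IsDiagonalPMap e l A) (hl : ∀ n, 0 ≤ l n) :
    ∃! T : ℝ≥0 → H →L[ℝ] H, IsSemigroupOf A T := by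
  have hb : ∀ (t : ℝ≥0) n, |Real.exp (-(t * l n))| ≤ 1 := fun t n => by
    rw [Real.abs_exp, Real.exp_le_one_iff]
    exact neg_nonpos.2 (mul_nonneg t.2 (hl n))
  choose T _ hT using fun t : ℝ≥0 => exists_diagonal e zero_le_one (hb t)
  replace hT : ∀ t : ℝ≥0, IsDiagonal e (fun n => Real.exp (-(t * l n))) (T t) := hT
  refine ⟨T, ⟨?_, fun s t => ?_, fun f => ?_, fun f g => ⟨fun h => ?_, fun h => ?_⟩⟩,
    fun S hS => funext fun t => (hA.isDiagonal hl hS t).unique (hT t)⟩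
  · refine IsDiagonal.unique (e := e) (c := fun _ => 1) ?_ isDiagonal_one
    simpa using hT 0
  · refine (hT (s + t)).unique ?_
    convert (hT s).mul (hT t) using 2 with n
    rw [← Real.exp_add, NNReal.coe_add]
    ring_nf
  · refine continuous_iff_continuousAt.2 fun t => ?_
    refine IsDiagonal.tendsto hT (hT t) hb (hb t) (fun n => ?_) f
    exact Continuous.tendsto (by fun_prop) t
  · rw [hA] at h
    -- For `t > 0`, `t⁻¹ (f - T t f)` is the multiplier `φ t` applied to `g = A f`. It is bounded by
    -- `1`, since `1 - exp (-x) ≤ x`, and tends to `1` pointwise, so dominated convergence applies.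
    -- The value `1` is the limit at `x = 0`.
    let φ : ℝ≥0 → ℕ → ℝ := fun t n => if t * l n = 0 then 1 else
      (1 - Real.exp (-(t * l n))) / (t * l n)
    have hφ : ∀ t n, |φ t n| ≤ 1 := fun t n => by
      have h0 : 0 ≤ t * l n := mul_nonneg t.2 (hl n)
      simp only [φ]
      split_ifs with h1
      · simp
      · have h2 : 0 < t * l n := lt_of_le_of_ne h0 (Ne.symm h1)
        rw [abs_of_nonneg (div_nonneg (by simpa using h0) h0), div_le_one h2]
        linarith [Real.add_one_le_exp (-(t * l n))]
    choose S _ hS using fun t => exists_diagonal e zero_le_one (hφ t)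
    have hlim : ∀ n, Tendsto (fun t : ℝ≥0 => φ t n) (𝓝[>] 0) (𝓝 1) := fun n => by
      by_cases h0 : l n = 0
      · simp [φ, h0]
      · have := (tendsto_one_sub_exp_div (l n)).mul_const (l n)⁻¹
        rw [mul_inv_cancel₀ h0] at this
        refine this.congr' ?_
        filter_upwards [self_mem_nhdsWithin] with t (ht : 0 < t)
        have ht' : (t : ℝ) ≠ 0 := by exact_mod_cast ht.ne'
        simp only [φ, mul_eq_zero, ht', h0, or_self, if_false]
        field_simp
    have := IsDiagonal.tendsto (e := e) hS isDiagonal_one hφ (by simp) hlim g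
    refine this.congr' ?_
    filter_upwards [self_mem_nhdsWithin] with t (ht : 0 < t)
    refine hilbertBasis_ext e fun n => ?_
    have ht' : (t : ℝ) ≠ 0 := by exact_mod_cast ht.ne'
    rw [hS, h n, inner_smul_right, inner_sub_right, hT t]
    simp only [φ]
    split_ifs with h1
    · have : l n = 0 := by simpa [ht'] using h1
      simp [this]
    · have : l n ≠ 0 := right_ne_zero_of_mul h1
      field_simp
  · rw [hA]
    intro n
    have h1 : Tendsto (fun t : ℝ≥0 => inner ℝ (e n) ((t : ℝ)⁻¹ • (f - T t f))) (𝓝[>] 0)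
      (𝓝 (inner ℝ (e n) g)) := tendsto_const_nhds.inner h
    refine tendsto_nhds_unique h1 ?_
    refine ((tendsto_one_sub_exp_div (l n)).mul_const (inner ℝ (e n) f)).congr fun t => ?_
    rw [inner_smul_right, inner_sub_right, hT t]
    ring

end DiagonalGenerator

/-! ### Closedness of the logarithmic form -/

section FormClosed

variable {X : Type*} [MetricSpace X] [SecondCountableTopology X] [MeasurableSpace X]
  [BorelSpace X] (μ : Measure X) [IsFiniteMeasure μ] (δ : ℝ)

/-- The difference quotient `(f(x) - f(y)) / d(x, y) ^ (δ / 2)`. -/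
def diffQuot (f : X → ℝ) (z : X × X) : ℝ :=
  (f z.1 - f z.2) / √(dist z.1 z.2 ^ δ)

theorem diffQuot_mul (f g : X → ℝ) (z : X × X) :
    diffQuot δ f z * diffQuot δ g z = kernel δ f g z := by
  have hc : 0 ≤ dist z.1 z.2 ^ δ := by positivity
  rw [diffQuot, diffQuot, kernel, div_mul_div_comm, Real.mul_self_sqrt hc]

theorem aestronglyMeasurable_diffQuot (f : Lp ℝ 2 μ) :
    AEStronglyMeasurable (diffQuot δ f) (μ.prod μ) := by
  have hf := Lp.aestronglyMeasurable f
  have hd : Measurable fun z : X × X => (√(dist z.1 z.2 ^ δ))⁻¹ := by fun_prop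
  exact ((hf.comp_fst (ν := μ)).sub (hf.comp_snd (μ := μ))).mul hd.aestronglyMeasurable

theorem mem_formDomain_iff_memLp {f : Lp ℝ 2 μ} :
    f ∈ formDomain μ δ ↔ MemLp (diffQuot δ f) 2 (μ.prod μ) := by
  rw [mem_formDomain, memLp_two_iff_integrable_sq (aestronglyMeasurable_diffQuot μ δ f)]
  simp only [sq, diffQuot_mul]

theorem diffQuot_congr {f g : X → ℝ} (h : f =ᵐ[μ] g) :
    diffQuot δ f =ᵐ[μ.prod μ] diffQuot δ g := by
  filter_upwards [(Measure.quasiMeasurePreserving_fst (μ := μ) (ν := μ)).ae h,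
    (Measure.quasiMeasurePreserving_snd (μ := μ) (ν := μ)).ae h] with z a b
  simp only [diffQuot, a, b]

/-- The difference quotient as a linear map into `L²(X × X)`. -/
def diffQuotLp : formDomain μ δ →ₗ[ℝ] Lp ℝ 2 (μ.prod μ) where
  toFun f := ((mem_formDomain_iff_memLp μ δ).1 f.2).toLp _
  map_add' f g := by
    rw [← MemLp.toLp_add, MemLp.toLp_eq_toLp_iff]
    refine (diffQuot_congr μ δ (Lp.coeFn_add f.1 g.1)).trans (.of_eq ?_)
    ext z
    simp only [diffQuot, Pi.add_apply]
    ring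
  map_smul' c f := by
    rw [RingHom.id_apply, ← MemLp.toLp_const_smul, MemLp.toLp_eq_toLp_iff]
    refine (diffQuot_congr μ δ (Lp.coeFn_smul c f.1)).trans (.of_eq ?_)
    ext z
    simp only [diffQuot, Pi.smul_apply, smul_eq_mul]
    ring

theorem coeFn_diffQuotLp (f : formDomain μ δ) :
    diffQuotLp μ δ f =ᵐ[μ.prod μ] diffQuot δ f.1 :=
  MemLp.coeFn_toLp ((mem_formDomain_iff_memLp μ δ).1 f.2)

theorem logForm_apply (f g : formDomain μ δ) :
    logForm μ δ f g = 1 / 2 * ∫ z, kernel δ f.1 g.1 z ∂(μ.prod μ) := rfl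

/-- Up to the factor `1 / 2` the form is pulled back from a Hilbert space, so its closedness is that
of the linear map `diffQuotLp`. -/
theorem logForm_eq_inner (f g : formDomain μ δ) :
    logForm μ δ f g = 1 / 2 * inner ℝ (diffQuotLp μ δ f) (diffQuotLp μ δ g) := by
  rw [logForm_apply, L2.inner_def]
  congr 1
  refine integral_congr_ae ?_
  filter_upwards [coeFn_diffQuotLp μ δ f, coeFn_diffQuotLp μ δ g] with z hf hg
  rw [hf, hg, ← diffQuot_mul]
  simp [mul_comm]

theorem logForm_comm (f g : formDomain μ δ) : logForm μ δ f g = logForm μ δ g f := by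
  rw [logForm_eq_inner, logForm_eq_inner, real_inner_comm]

theorem exists_seq_tendsto_ae_of_tendsto_Lp {α : Type*} [MeasurableSpace α] {ν : Measure α}
    {u : ℕ → Lp ℝ 2 ν} {f : Lp ℝ 2 ν} (h : Tendsto u atTop (𝓝 f)) :
    ∃ k : ℕ → ℕ, StrictMono k ∧ ∀ᵐ x ∂ν, Tendsto (fun n => u (k n) x) atTop (𝓝 (f x)) :=
  (tendstoInMeasure_of_tendsto_Lp h).exists_seq_tendsto_ae

/-- The logarithmic form is closed. -/
theorem diffQuotLp_closed {u : ℕ → formDomain μ δ} {f : Lp ℝ 2 μ} {G : Lp ℝ 2 (μ.prod μ)}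
    (hu : Tendsto (fun n => (u n : Lp ℝ 2 μ)) atTop (𝓝 f))
    (hG : Tendsto (fun n => diffQuotLp μ δ (u n)) atTop (𝓝 G)) :
    ∃ h : f ∈ formDomain μ δ, diffQuotLp μ δ ⟨f, h⟩ = G := by
  -- Along a common subsequence both `u` and its difference quotients converge almost everywhere,
  -- which identifies `G` pointwise.
  obtain ⟨k, hk, hk'⟩ := exists_seq_tendsto_ae_of_tendsto_Lp hu
  obtain ⟨j, hj, hj'⟩ := exists_seq_tendsto_ae_of_tendsto_Lp (hG.comp hk.tendsto_atTop)
  have hall : ∀ᵐ z ∂(μ.prod μ), ∀ n, diffQuotLp μ δ (u n) z = diffQuot δ (u n).1 z :=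
    ae_all_iff.2 fun n => coeFn_diffQuotLp μ δ (u n)
  have hfG : diffQuot δ f =ᵐ[μ.prod μ] G := by
    filter_upwards [(Measure.quasiMeasurePreserving_fst (μ := μ) (ν := μ)).ae hk',
      (Measure.quasiMeasurePreserving_snd (μ := μ) (ν := μ)).ae hk', hj', hall] with z h1 h2 h3 h4
    refine tendsto_nhds_unique ?_ h3
    simp only [Function.comp, h4]
    exact ((h1.sub h2).div_const _).comp hj.tendsto_atTop
  have hf : f ∈ formDomain μ δ :=
    (mem_formDomain_iff_memLp μ δ).2 ((memLp_congr_ae hfG).2 (Lp.memLp G))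
  exact ⟨hf, Lp.ext ((coeFn_diffQuotLp μ δ _).trans hfG)⟩

/-- One inclusion is symmetry of the form tested against `e n`. For maximality, the point is that
the coefficient relation forces `f` into the form domain: the partial sums of its expansion are
Cauchy in the form norm, and the form is closed. -/
theorem isDiagonalPMap_formOperator {e : HilbertBasis ℕ ℝ (Lp ℝ 2 μ)} {l : ℕ → ℝ}
    (he : ∀ n, (e n, l n • e n) ∈ formGraph (formDomain μ δ) (logForm μ δ)) :
    IsDiagonalPMap e l (logLaplacian μ δ) := by
  have hmem : ∀ n, e n ∈ formDomain μ δ := fun n => by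
    obtain ⟨u, hu, -⟩ := he n
    change (u : Lp ℝ 2 μ) = e n at hu
    exact hu ▸ u.2
  have hform : ∀ n (h : formDomain μ δ), logForm μ δ ⟨e n, hmem n⟩ h =
      l n * inner ℝ (e n) (h : Lp ℝ 2 μ) := fun n h => by
    obtain ⟨u, hu, hu'⟩ := he n
    rw [← real_inner_smul_left, ← hu' h]
    congr
    exact hu.symm
  have hdense : Dense (formDomain μ δ : Set (Lp ℝ 2 μ)) := by
    refine (Submodule.dense_iff_topologicalClosure_eq_top.2 e.dense_span).mono ?_
    refine Submodule.span_le.2 ?_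
    rintro _ ⟨n, rfl⟩
    exact hmem n
  intro f g
  rw [logLaplacian, formOperator_graph _ _ hdense]
  constructor
  · rintro ⟨u, rfl, hu⟩ n
    rw [real_inner_comm, ← hu ⟨e n, hmem n⟩, logForm_comm, hform]
  intro hfg
  let v : ℕ → formDomain μ δ := fun n => inner ℝ (e n) f • ⟨e n, hmem n⟩
  have hv : ∀ n h, logForm μ δ (v n) h = inner ℝ (e n) g * inner ℝ (e n) (h : Lp ℝ 2 μ) :=
    fun n h => by
      simp only [v, map_smul, LinearMap.smul_apply, smul_eq_mul, hform, hfg]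
      ring
  -- The images of the `v n` are pairwise orthogonal, so the series in `L²(X × X)` converges once
  -- its squared norms are summable. This follows from `f, g ∈ L²` by Parseval.
  have hvn : ∀ s : Finset ℕ, ‖∑ n ∈ s, diffQuotLp μ δ (v n)‖ ^ 2 =
      ∑ n ∈ s, 2 * (inner ℝ (e n) f * inner ℝ (e n) g) := fun s => by
    have h1 : ∀ m n, inner ℝ (diffQuotLp μ δ (v m)) (diffQuotLp μ δ (v n)) =
        2 * logForm μ δ (v m) (v n) := fun m n => by
      rw [logForm_eq_inner]
      ring
    rw [← real_inner_self_eq_norm_sq, sum_inner]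
    refine Finset.sum_congr rfl fun m hm => ?_
    rw [inner_sum, Finset.sum_congr rfl fun n _ => by rw [h1, hv]]
    simp only [v, Submodule.coe_smul, inner_smul_right, inner_basis]
    simp [hm]
    ring
  have hsum : Summable fun n => 2 * (inner ℝ (e n) f * inner ℝ (e n) g) := by
    refine (Summable.congr (e.summable_inner_mul_inner f g) fun n => ?_).mul_left 2
    rw [real_inner_comm f]
  have hsumm : Summable fun n => diffQuotLp μ δ (v n) := by
    rw [summable_iff_vanishing_norm] at hsum ⊢
    intro ε hε
    obtain ⟨s, hs⟩ := hsum (ε ^ 2) (by positivity)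
    refine ⟨s, fun t ht => ?_⟩
    have h2 := hs t ht
    rw [← hvn, Real.norm_eq_abs, abs_of_nonneg (sq_nonneg _)] at h2
    exact lt_of_pow_lt_pow_left₀ 2 hε.le h2
  obtain ⟨G, hG⟩ := hsumm
  have hlim : Tendsto (fun N => ((∑ n ∈ Finset.range N, v n : formDomain μ δ) : Lp ℝ 2 μ))
      atTop (𝓝 f) := by
    have := (e.hasSum_repr f).tendsto_sum_nat
    refine this.congr fun N => ?_
    simp [v, e.repr_apply_apply]
  have hlim2 : Tendsto (fun N => diffQuotLp μ δ (∑ n ∈ Finset.range N, v n)) atTop (𝓝 G) := by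
    simpa only [map_sum] using hG.tendsto_sum_nat
  obtain ⟨hf, hfG⟩ := diffQuotLp_closed μ δ hlim hlim2
  refine ⟨⟨f, hf⟩, rfl, fun h => ?_⟩
  refine tendsto_nhds_unique (f := fun N => logForm μ δ (∑ n ∈ Finset.range N, v n) h)
    (l := atTop) ?_ ?_
  · simp only [logForm_eq_inner, hfG]
    exact (hlim2.inner tendsto_const_nhds).const_mul _
  · simp only [map_sum, LinearMap.sum_apply, hv]
    refine Tendsto.congr (fun N => Finset.sum_congr rfl fun n _ => ?_)
      (e.hasSum_inner_mul_inner g (h : Lp ℝ 2 μ)).tendsto_sum_nat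
    rw [real_inner_comm g]

end FormClosed

/-! ### Lipschitz functions -/

section Lipschitz

variable {X : Type*} [MetricSpace X] [SecondCountableTopology X] [MeasurableSpace X]
  [BorelSpace X] (μ : Measure X) [IsFiniteMeasure μ]

/-- `∫ (φ(x) - φ(y)) / d(x, y) dμ(y)`. -/
def lipLaplacian (φ : X → ℝ) (x : X) : ℝ := ∫ y, (φ x - φ y) / dist x y ∂μ

variable {μ} {φ : X → ℝ} {K : ℝ≥0}

theorem abs_sub_div_dist_le (hφ : LipschitzWith K φ) (x y : X) :
    |(φ x - φ y) / dist x y| ≤ K := by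
  rw [abs_div, abs_of_nonneg (dist_nonneg (x := x) (y := y)), ← Real.dist_eq]
  exact div_le_of_le_mul₀ dist_nonneg K.2 (hφ.dist_le_mul x y)

theorem stronglyMeasurable_sub_div_dist (hφ : LipschitzWith K φ) :
    StronglyMeasurable fun z : X × X => (φ z.1 - φ z.2) / dist z.1 z.2 := by
  have := hφ.continuous.measurable
  have h : Measurable fun z : X × X => (φ z.1 - φ z.2) / dist z.1 z.2 := by fun_prop
  exact h.stronglyMeasurable

theorem memLp_lipLaplacian (hφ : LipschitzWith K φ) : MemLp (lipLaplacian μ φ) 2 μ := by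
  refine MemLp.of_bound (stronglyMeasurable_sub_div_dist hφ).integral_prod_right.aestronglyMeasurable
    (K * μ.real Set.univ) (.of_forall fun x => ?_)
  exact norm_integral_le_of_norm_le_const (.of_forall fun y => abs_sub_div_dist_le hφ x y)

/-- For `δ = 1` the Lipschitz bound cancels the singularity, leaving a bounded antisymmetric kernel
`a`. The terms with `g x` and `g y` are then separately integrable, and swapping variables makes
them contribute equally, which absorbs the factor `1 / 2`. -/
theorem mem_formGraph_of_lipschitz (hφ : LipschitzWith K φ) {f : Lp ℝ 2 μ} (hf : f =ᵐ[μ] φ) :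
    (f, (memLp_lipLaplacian hφ).toLp (lipLaplacian μ φ)) ∈
      formGraph (formDomain μ 1) (logForm μ 1) := by
  let a : X × X → ℝ := fun z => (φ z.1 - φ z.2) / dist z.1 z.2
  have hk : ∀ g : Lp ℝ 2 μ, kernel 1 f g =ᵐ[μ.prod μ]
      fun z => a z * g z.1 - a z * g z.2 := fun g => by
    refine (kernel_congr μ 1 hf (EventuallyEq.refl _ _)).trans (.of_eq ?_)
    ext z
    simp only [kernel, a, Real.rpow_one]
    ring
  have hint : ∀ g : Lp ℝ 2 μ, Integrable g μ := fun g => (Lp.memLp g).integrable (by norm_num)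
  have h1 : ∀ g : Lp ℝ 2 μ, Integrable (fun z : X × X => a z * g z.1) (μ.prod μ) := fun g =>
    ((hint g).comp_fst μ).bdd_mul (stronglyMeasurable_sub_div_dist hφ).aestronglyMeasurable
      (.of_forall fun z => abs_sub_div_dist_le hφ z.1 z.2)
  have h2 : ∀ g : Lp ℝ 2 μ, Integrable (fun z : X × X => a z * g z.2) (μ.prod μ) := fun g =>
    ((hint g).comp_snd μ).bdd_mul (stronglyMeasurable_sub_div_dist hφ).aestronglyMeasurable
      (.of_forall fun z => abs_sub_div_dist_le hφ z.1 z.2)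
  have hfD : f ∈ formDomain μ 1 := ((h1 f).sub (h2 f)).congr (hk f).symm
  refine ⟨⟨f, hfD⟩, rfl, fun g => ?_⟩
  have h3 : ∫ z, a z * (g : Lp ℝ 2 μ) z.2 ∂(μ.prod μ) =
      - ∫ z, a z * (g : Lp ℝ 2 μ) z.1 ∂(μ.prod μ) := by
    rw [← integral_prod_swap, ← integral_neg]
    congr 1 with z
    simp only [a, Prod.fst_swap, Prod.snd_swap, dist_comm z.2 z.1]
    ring
  rw [logForm_apply, integral_congr_ae (hk g), integral_sub (h1 g) (h2 g), h3,
    integral_prod _ (h1 g), L2.inner_def]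
  have h4 : ∫ x, inner ℝ ((memLp_lipLaplacian hφ).toLp (lipLaplacian μ φ) x)
      ((g : Lp ℝ 2 μ) x) ∂μ = ∫ x, ∫ y, a (x, y) * (g : Lp ℝ 2 μ) x ∂μ ∂μ := by
    refine integral_congr_ae ?_
    filter_upwards [(memLp_lipLaplacian (μ := μ) hφ).coeFn_toLp] with x hx
    rw [hx, integral_mul_const]
    simp [lipLaplacian, a, mul_comm]
  rw [h4]
  ring

end Lipschitz

/-! ### Polynomials in `L²([-1, 1])` -/

section Polynomials

open Polynomial

/-- A polynomial as an element of `L²([-1, 1])`. -/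
def polyLp : ℝ[X] →ₗ[ℝ] L2Interval :=
  (ContinuousMap.toLp (E := ℝ) 2 lebesgue ℝ).toLinearMap ∘ₗ
    (toContinuousMapOnAlgHom (Set.Icc (-1 : ℝ) 1)).toLinearMap

theorem legendreLp_eq (n : ℕ) : legendreLp n = polyLp (legendre n) := rfl

theorem coeFn_polyLp (p : ℝ[X]) : polyLp p =ᵐ[lebesgue] fun x : Interval => p.eval (x : ℝ) :=
  ContinuousMap.coeFn_toLp lebesgue (𝕜 := ℝ) (p.toContinuousMapOn (Set.Icc (-1 : ℝ) 1))

theorem integral_lebesgue (f : ℝ → ℝ) :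
    ∫ x : Interval, f x ∂lebesgue = ∫ x in (-1 : ℝ)..1, f x := by
  rw [integral_subtype_comap measurableSet_Icc, integral_Icc_eq_integral_Ioc,
    intervalIntegral.integral_of_le (by norm_num)]

theorem inner_polyLp (p q : ℝ[X]) :
    inner ℝ (polyLp p) (polyLp q) = ∫ x in (-1 : ℝ)..1, p.eval x * q.eval x := by
  rw [← integral_lebesgue, L2.inner_def]
  refine integral_congr_ae ?_
  filter_upwards [coeFn_polyLp p, coeFn_polyLp q] with x hp hq
  rw [hp, hq]
  simp [mul_comm]

theorem polyLp_eq_zero {p : ℝ[X]} (h : polyLp p = 0) : p = 0 := by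
  by_contra hp
  have h0 : ∫ x in (-1 : ℝ)..1, p.eval x * p.eval x = 0 := by
    rw [← inner_polyLp, h, inner_zero_left]
  have hc : ∃ c ∈ Set.Icc (-1 : ℝ) 1, p.eval c ≠ 0 := by
    by_contra! hc
    exact hp (eq_zero_of_infinite_isRoot p ((Set.Icc_infinite (by norm_num)).mono hc))
  obtain ⟨c, hc, hc'⟩ := hc
  refine (intervalIntegral.integral_pos (f := fun x => p.eval x * p.eval x)
    (by norm_num : (-1 : ℝ) < 1) (Continuous.continuousOn (by fun_prop)) (fun x _ => mul_self_nonneg _)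
    ⟨c, hc, mul_self_pos.2 hc'⟩).ne' h0

theorem lipschitzWith_eval (p : ℝ[X]) :
    ∃ K : ℝ≥0, LipschitzWith K fun x : Interval => p.eval (x : ℝ) := by
  obtain ⟨C, hC⟩ := (isCompact_Icc (a := (-1 : ℝ)) (b := 1)).exists_bound_of_continuousOn
    (f := fun x => p.derivative.eval x) (Continuous.continuousOn (by fun_prop))
  refine ⟨C.toNNReal, ?_⟩
  have h := (convex_Icc (-1 : ℝ) 1).lipschitzOnWith_of_nnnorm_deriv_le (f := fun x => p.eval x)
    (C := C.toNNReal) (fun x _ => p.differentiableAt) fun x hx => by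
      rw [Polynomial.deriv, ← NNReal.coe_le_coe, coe_nnnorm]
      exact (hC x hx).trans (Real.le_coe_toNNReal C)
  exact h.to_restrict

theorem dense_range_polyLp : Dense (LinearMap.range polyLp : Set L2Interval) := by
  have h1 : DenseRange (toContinuousMapOnAlgHom (Set.Icc (-1 : ℝ) 1)) := by
    rw [DenseRange, ← polynomialFunctions_coe, dense_iff_closure_eq,
      ← Subalgebra.topologicalClosure_coe, polynomialFunctions_closure_eq_top, Algebra.coe_top]
  exact (ContinuousMap.toLp_denseRange (p := 2) ℝ lebesgue ℝ (by norm_num)).comp h1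
    (ContinuousMap.toLp (E := ℝ) 2 lebesgue ℝ).continuous

/-! ### The logarithmic Laplacian of a polynomial -/

/-- `∫_{-1}^1 (xⁿ - yⁿ) / |x - y| dy` as a polynomial in `x`. -/
def lapMonomial (n : ℕ) : ℝ[X] :=
  C (2 * (harmonic n : ℝ)) * X ^ n -
    ∑ i ∈ Finset.range n, C ((1 + (-1) ^ (i + 1)) / ((i : ℝ) + 1)) * X ^ (n - 1 - i)

/-- On either side of `x` the integrand is `±` the geometric sum `∑ y ^ i x ^ (n - 1 - i)`. After
integration the endpoint `x` contributes `2 x ^ n / (i + 1)` for each `i`, hence the harmonic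
number; the endpoints `±1` contribute only lower powers. -/
theorem integral_pow_sub_pow_div (n : ℕ) {x : ℝ} (hx : x ∈ Set.Icc (-1 : ℝ) 1) :
    ∫ y in (-1 : ℝ)..1, (x ^ n - y ^ n) / |x - y| = (lapMonomial n).eval x := by
  let g : ℝ → ℝ := fun y => ∑ i ∈ Finset.range n, y ^ i * x ^ (n - 1 - i)
  have hg : ∀ y, g y * (y - x) = y ^ n - x ^ n := fun y => geom_sum₂_mul y x n
  have hgc : Continuous g := by fun_prop
  have h1 : Set.EqOn (fun y => (x ^ n - y ^ n) / |x - y|) g (Set.Ioo (-1) x) := fun y hy => by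
    have hxy : 0 < x - y := sub_pos.2 hy.2
    simp only
    rw [abs_of_pos hxy, div_eq_iff hxy.ne']
    linarith [hg y]
  have h2 : Set.EqOn (fun y => (x ^ n - y ^ n) / |x - y|) (fun y => - g y) (Set.Ioo x 1) :=
    fun y hy => by
      have hxy : x - y < 0 := sub_neg.2 hy.1
      simp only
      rw [abs_of_neg hxy, div_eq_iff (neg_ne_zero.2 hxy.ne)]
      linarith [hg y]
  have hi1 : IntervalIntegrable (fun y => (x ^ n - y ^ n) / |x - y|) volume (-1) x := by
    rw [intervalIntegrable_congr_uIoo (Set.uIoo_of_le hx.1 ▸ h1)]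
    exact hgc.intervalIntegrable _ _
  have hi2 : IntervalIntegrable (fun y => (x ^ n - y ^ n) / |x - y|) volume x 1 := by
    rw [intervalIntegrable_congr_uIoo (Set.uIoo_of_le hx.2 ▸ h2)]
    exact hgc.neg.intervalIntegrable _ _
  have hint : ∀ a b : ℝ, ∫ y in a..b, g y = ∑ i ∈ Finset.range n,
      (b ^ (i + 1) - a ^ (i + 1)) / ((i : ℝ) + 1) * x ^ (n - 1 - i) := fun a b => by
    rw [intervalIntegral.integral_finsetSum fun i _ =>
      Continuous.intervalIntegrable (by fun_prop) _ _]
    refine Finset.sum_congr rfl fun i _ => ?_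
    rw [intervalIntegral.integral_mul_const, integral_pow]
  rw [← intervalIntegral.integral_add_adjacent_intervals hi1 hi2,
    intervalIntegral.integral_congr_Ioo_of_le hx.1 h1,
    intervalIntegral.integral_congr_Ioo_of_le hx.2 h2, intervalIntegral.integral_neg, hint, hint,
    lapMonomial, harmonic]
  simp only [eval_sub, eval_mul, eval_C, eval_pow, eval_X, eval_finsetSum]
  push_cast
  rw [Finset.mul_sum, Finset.sum_mul, ← sub_eq_add_neg, ← Finset.sum_sub_distrib,
    ← Finset.sum_sub_distrib]
  refine Finset.sum_congr rfl fun i hi => ?_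
  have hn : n = (i + 1) + (n - 1 - i) := by
    have := Finset.mem_range.1 hi
    omega
  have hxn : x ^ n = x ^ (i + 1) * x ^ (n - 1 - i) := by
    rw [← pow_add, ← hn]
  have : (i : ℝ) + 1 ≠ 0 := by positivity
  rw [hxn, one_pow]
  field_simp
  ring

/-- The logarithmic Laplacian on polynomials. -/
def lapPoly : ℝ[X] →ₗ[ℝ] ℝ[X] := (basisMonomials ℝ).constr ℝ lapMonomial

theorem lapPoly_X_pow (n : ℕ) : lapPoly (X ^ n) = lapMonomial n := by
  have := (basisMonomials ℝ).constr_basis ℝ lapMonomial n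
  rw [← monomial_one_right_eq_X_pow]
  rwa [coe_basisMonomials] at this

theorem polyLp_mem_formGraph (p : ℝ[X]) :
    (polyLp p, polyLp (lapPoly p)) ∈ formGraph (formDomain lebesgue 1) (logForm lebesgue 1) := by
  -- The claim is a linear condition on `p`, so monomials suffice.
  let F : ℝ[X] →ₗ[ℝ] L2Interval × L2Interval := polyLp.prod (polyLp ∘ₗ lapPoly)
  suffices ⊤ ≤ (formGraph (formDomain lebesgue 1) (logForm lebesgue 1)).comap F from
    this (Submodule.mem_top (x := p))
  rw [← (basisMonomials ℝ).span_eq, Submodule.span_le]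
  rintro _ ⟨n, rfl⟩
  rw [coe_basisMonomials]
  simp only [monomial_one_right_eq_X_pow]
  change (polyLp (X ^ n), polyLp (lapPoly (X ^ n))) ∈
    formGraph (formDomain lebesgue 1) (logForm lebesgue 1)
  obtain ⟨K, hK⟩ := lipschitzWith_eval (X ^ n)
  have h := mem_formGraph_of_lipschitz hK (coeFn_polyLp (X ^ n))
  convert h using 2
  refine Lp.ext ?_
  filter_upwards [coeFn_polyLp (lapPoly (X ^ n)),
    (memLp_lipLaplacian (μ := lebesgue) hK).coeFn_toLp] with x hx hx'
  rw [hx, hx', lapPoly_X_pow, ← integral_pow_sub_pow_div n x.2, lipLaplacian, ← integral_lebesgue]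
  simp [Subtype.dist_eq, Real.dist_eq]

theorem lapMonomial_mem (n : ℕ) :
    lapMonomial n - C (2 * (harmonic n : ℝ)) * X ^ n ∈ degreeLT ℝ n := by
  rw [lapMonomial, sub_sub_cancel_left]
  refine Submodule.neg_mem _ (Submodule.sum_mem _ fun i hi => ?_)
  rw [mem_degreeLT]
  refine (degree_C_mul_X_pow_le _ _).trans_lt ?_
  have := Finset.mem_range.1 hi
  exact_mod_cast (by omega : n - 1 - i < n)

theorem lapPoly_mem_degreeLT {n : ℕ} {p : ℝ[X]} (hp : p ∈ degreeLT ℝ n) :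
    lapPoly p ∈ degreeLT ℝ n := by
  suffices degreeLT ℝ n ≤ (degreeLT ℝ n).comap lapPoly from this hp
  conv_lhs => rw [degreeLT_eq_span_X_pow]
  rw [Submodule.span_le]
  intro q hq
  simp only [Finset.coe_image, Set.mem_image, Finset.mem_coe, Finset.mem_range] at hq
  obtain ⟨k, hk, rfl⟩ := hq
  rw [SetLike.mem_coe, Submodule.mem_comap, lapPoly_X_pow]
  have h1 := degreeLT_mono hk.le (lapMonomial_mem k)
  have h2 : C (2 * (harmonic k : ℝ)) * X ^ k ∈ degreeLT ℝ n :=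
    mem_degreeLT.2 ((degree_C_mul_X_pow_le _ _).trans_lt (by exact_mod_cast hk))
  simpa using add_mem h1 h2

/-- `lapPoly` is triangular on monomials with diagonal entries `2 h_n`; only the leading term `a X ^
n` matters modulo lower degree. -/
theorem lapPoly_sub_mem_degreeLT {n : ℕ} {p : ℝ[X]} (hp : p.degree ≤ n) :
    lapPoly p - (2 * (harmonic n : ℝ)) • p ∈ degreeLT ℝ n := by
  set a := p.coeff n
  have hq : p - a • X ^ n ∈ degreeLT ℝ n := by
    rw [mem_degreeLT, degree_lt_iff_coeff_zero]
    intro m hm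
    rw [coeff_sub, coeff_smul, coeff_X_pow]
    split_ifs with h
    · subst h
      simp [a]
    · simp [coeff_eq_zero_of_degree_lt (hp.trans_lt (by exact_mod_cast (by omega : n < m)))]
  have h1 := lapPoly_mem_degreeLT hq
  have h2 := Submodule.smul_mem _ (2 * (harmonic n : ℝ)) hq
  have h3 := Submodule.smul_mem _ a (lapMonomial_mem n)
  convert sub_mem (add_mem h1 h3) h2 using 1
  rw [map_sub, map_smul, lapPoly_X_pow, ← smul_eq_C_mul]
  module

/-! ### Legendre polynomials -/

theorem degree_legendre (n : ℕ) : (legendre n).degree = n := by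
  have hdeg : ((X ^ 2 - 1 : ℝ[X]) ^ n).natDegree = 2 * n := by
    rw [natDegree_pow]
    have : (X ^ 2 - 1 : ℝ[X]).natDegree = 2 := natDegree_X_pow_sub_C (r := (1 : ℝ))
    rw [this, mul_comm]
  have hmonic : ((X ^ 2 - 1 : ℝ[X]) ^ n).Monic :=
    (monic_X_pow_sub_C (1 : ℝ) two_ne_zero).pow n
  refine degree_eq_of_le_of_coeff_ne_zero ?_ ?_
  · refine (degree_smul_le _ _).trans (degree_le_of_natDegree_le ?_)
    have := natDegree_iterate_derivative ((X ^ 2 - 1 : ℝ[X]) ^ n) n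
    omega
  -- The leading coefficient comes from the monic top term `X ^ (2 n)`, differentiated `n` times.
  · rw [legendre, coeff_smul, coeff_iterate_derivative, smul_eq_mul, nsmul_eq_mul, ← two_mul,
      ← hdeg, hmonic.coeff_natDegree, hdeg, mul_one]
    have : (2 * n).descFactorial n ≠ 0 := by
      rw [Ne, Nat.descFactorial_eq_zero_iff_lt]
      omega
    positivity

theorem eval_iterate_derivative_eq_zero {n k : ℕ} (hk : k < n) {x : ℝ} (hx : x ^ 2 = 1) :
    (derivative^[k] ((X ^ 2 - 1 : ℝ[X]) ^ n)).eval x = 0 := by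
  obtain ⟨q, hq⟩ := pow_sub_dvd_iterate_derivative_pow (X ^ 2 - 1 : ℝ[X]) n k
  have : n - k ≠ 0 := by omega
  rw [hq]
  simp [hx, this]

/-- Repeated integration by parts with `n` fixed: each step moves one derivative onto `q` and lowers
its degree bound. Boundary terms vanish because `(x² - 1) ^ n` has zeros of order `n` at `±1`. -/
theorem integral_iterate_derivative_mul {n k : ℕ} (hk : k ≤ n) {q : ℝ[X]} (hq : q ∈ degreeLT ℝ k) :
    ∫ x in (-1 : ℝ)..1, (derivative^[k] ((X ^ 2 - 1 : ℝ[X]) ^ n)).eval x * q.eval x = 0 := by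
  induction k generalizing q with
  | zero =>
    have : q = 0 := by simpa [mem_degreeLT, Nat.WithBot.lt_zero_iff] using hq
    simp [this]
  | succ k ih =>
    have hq' : derivative q ∈ degreeLT ℝ k := by
      rcases eq_or_ne q 0 with rfl | h0
      · simp
      · rw [mem_degreeLT] at hq ⊢
        have h1 := degree_derivative_lt h0
        rw [degree_eq_natDegree h0] at h1 hq
        refine h1.trans_le ?_
        have : q.natDegree < k + 1 := by exact_mod_cast hq
        exact_mod_cast (by omega : q.natDegree ≤ k)
    have hparts := intervalIntegral.integral_mul_deriv_eq_deriv_mul (a := (-1 : ℝ)) (b := 1)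
      (u := fun x => q.eval x) (u' := fun x => (derivative q).eval x)
      (v := fun x => (derivative^[k] ((X ^ 2 - 1 : ℝ[X]) ^ n)).eval x)
      (v' := fun x => (derivative^[k + 1] ((X ^ 2 - 1 : ℝ[X]) ^ n)).eval x)
      (fun x _ => q.hasDerivAt x)
      (fun x _ => by
        rw [Function.iterate_succ_apply']
        exact Polynomial.hasDerivAt _ x)
      (Continuous.intervalIntegrable (by fun_prop) _ _)
      (Continuous.intervalIntegrable (by fun_prop) _ _)
    rw [eval_iterate_derivative_eq_zero (by omega) (by norm_num),
      eval_iterate_derivative_eq_zero (by omega) (by norm_num)] at hparts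
    have h2 := ih (by omega) hq'
    simp only [mul_comm (eval _ q), mul_comm (eval _ (derivative q))] at hparts
    rw [hparts, h2]
    simp

theorem inner_legendre {n : ℕ} {q : ℝ[X]} (hq : q ∈ degreeLT ℝ n) :
    inner ℝ (polyLp (legendre n)) (polyLp q) = 0 := by
  rw [legendre, map_smul, real_inner_smul_left, inner_polyLp,
    integral_iterate_derivative_mul le_rfl hq, mul_zero]

theorem inner_legendre_of_ne {m n : ℕ} (h : m ≠ n) :
    inner ℝ (polyLp (legendre m)) (polyLp (legendre n)) = 0 := by
  rcases h.lt_or_gt with h | h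
  · rw [real_inner_comm]
    exact inner_legendre (mem_degreeLT.2 (by rw [degree_legendre]; exact_mod_cast h))
  · exact inner_legendre (mem_degreeLT.2 (by rw [degree_legendre]; exact_mod_cast h))

theorem inner_polyLp_lapPoly (p q : ℝ[X]) :
    inner ℝ (polyLp (lapPoly p)) (polyLp q) = inner ℝ (polyLp p) (polyLp (lapPoly q)) := by
  obtain ⟨u, hu, hu'⟩ := polyLp_mem_formGraph p
  obtain ⟨v, hv, hv'⟩ := polyLp_mem_formGraph q
  simp only at hu hu' hv hv'
  rw [← hv, ← hu' v, logForm_comm, hv' u, hu, real_inner_comm]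

/-- The remainder `r` has degree below `n`, and so does `lapPoly r`. Both are orthogonal to `p_n`,
so moving the operator onto `r` by symmetry gives `⟪r, r⟫ = 0`. -/
theorem polyLp_lapPoly_legendre (n : ℕ) :
    polyLp (lapPoly (legendre n)) = (2 * (harmonic n : ℝ)) • polyLp (legendre n) := by
  have hr := lapPoly_sub_mem_degreeLT (degree_legendre n).le
  set r := lapPoly (legendre n) - (2 * (harmonic n : ℝ)) • legendre n with hr_def
  have h0 : inner ℝ (polyLp r) (polyLp r) = 0 := by
    have : polyLp r = polyLp (lapPoly (legendre n)) -
        (2 * (harmonic n : ℝ)) • polyLp (legendre n) := by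
      rw [hr_def, map_sub, map_smul]
    conv_lhs => arg 2; rw [this]
    rw [inner_sub_left, real_inner_smul_left, inner_legendre hr,
      inner_polyLp_lapPoly, inner_legendre (lapPoly_mem_degreeLT hr), mul_zero, sub_zero]
  rw [inner_self_eq_zero, hr_def, map_sub, map_smul, sub_eq_zero] at h0
  exact h0

theorem legendreLp_ne_zero (n : ℕ) : legendreLp n ≠ 0 := fun h => by
  have := polyLp_eq_zero h
  have h1 := degree_legendre n
  rw [this, degree_zero] at h1
  exact absurd h1 (by simp)

theorem legendreLp_mem_formGraph (n : ℕ) : (legendreLp n, (2 * (harmonic n : ℝ)) • legendreLp n) ∈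
    formGraph (formDomain lebesgue 1) (logForm lebesgue 1) := by
  rw [legendreLp_eq, ← polyLp_lapPoly_legendre]
  exact polyLp_mem_formGraph _

theorem span_legendre : Submodule.span ℝ (Set.range legendre) = ⊤ := by
  let S : Polynomial.Sequence ℝ := ⟨legendre, degree_legendre⟩
  exact S.span fun i => (leadingCoeff_ne_zero.2 (S.ne_zero i)).isUnit

theorem orthonormal_legendreLp :
    Orthonormal ℝ fun n => ‖legendreLp n‖⁻¹ • legendreLp n := by
  refine ⟨fun n => ?_, fun m n h => ?_⟩
  · rw [norm_smul, norm_inv, norm_norm, inv_mul_cancel₀ (norm_ne_zero_iff.2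
      (legendreLp_ne_zero n))]
  · simp only [real_inner_smul_left, real_inner_smul_right, legendreLp_eq,
      inner_legendre_of_ne h, mul_zero]

/-- The normalized Legendre polynomials. -/
def legendreBasis : HilbertBasis ℕ ℝ L2Interval :=
  HilbertBasis.mk orthonormal_legendreLp
    (by
      rw [top_le_iff, ← Submodule.dense_iff_topologicalClosure_eq_top]
      refine dense_range_polyLp.mono ?_
      rw [SetLike.coe_subset_coe, LinearMap.range_eq_map, ← span_legendre, Submodule.map_span,
        Submodule.span_le]
      rintro _ ⟨_, ⟨n, rfl⟩, rfl⟩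
      have : polyLp (legendre n) = ‖legendreLp n‖ • (‖legendreLp n‖⁻¹ • legendreLp n) := by
        rw [smul_smul, mul_inv_cancel₀ (norm_ne_zero_iff.2 (legendreLp_ne_zero n)), one_smul,
          legendreLp_eq]
      rw [this]
      exact Submodule.smul_mem _ _ (Submodule.subset_span ⟨n, rfl⟩))

theorem legendreBasis_apply (n : ℕ) : legendreBasis n = ‖legendreLp n‖⁻¹ • legendreLp n := by
  rw [legendreBasis, HilbertBasis.coe_mk]

theorem isDiagonalPMap_intervalLaplacian :
    IsDiagonalPMap legendreBasis (fun n => 2 * (harmonic n : ℝ)) intervalLaplacian :=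
  isDiagonalPMap_formOperator lebesgue 1 fun n => by
    have := Submodule.smul_mem _ ‖legendreLp n‖⁻¹ (legendreLp_mem_formGraph n)
    rwa [Prod.smul_mk, smul_comm, ← legendreBasis_apply] at this

end Polynomials

/-! ### Harmonic numbers -/

section Harmonic

theorem harmonic_nonneg (n : ℕ) : 0 ≤ (harmonic n : ℝ) := by
  rw [harmonic]
  push_cast
  positivity

theorem tendsto_harmonic_atTop : Tendsto (fun n => (harmonic n : ℝ)) atTop atTop := by
  refine tendsto_atTop_mono (fun n => log_add_one_le_harmonic n) ?_
  exact Real.tendsto_log_atTop.comp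
    (tendsto_natCast_atTop_atTop.comp (tendsto_add_atTop_nat 1))

theorem summable_exp_harmonic_iff {t : ℝ} (ht : 0 ≤ t) :
    Summable (fun n => Real.exp (-(t * (2 * (harmonic n : ℝ))))) ↔ 1 / 2 < t := by
  have hpow : ∀ n : ℕ, 0 < n → Real.exp (-(t * (2 * Real.log n))) = (n : ℝ) ^ (-(2 * t)) :=
    fun n hn => by
      rw [Real.rpow_def_of_pos (by exact_mod_cast hn)]
      ring_nf
  constructor
  · intro h
    have h1 : Summable fun n : ℕ => (n : ℝ) ^ (-(2 * t)) := by
      rw [← summable_nat_add_iff 1] at h ⊢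
      -- The factor `exp (2 t)` pays for the `1` in `h_n ≤ 1 + log n`.
      refine Summable.of_nonneg_of_le (fun n => by positivity) (fun n => ?_)
        (h.mul_left (Real.exp (2 * t)))
      rw [← hpow (n + 1) n.succ_pos, ← Real.exp_add, Real.exp_le_exp]
      have := mul_le_mul_of_nonneg_left (harmonic_le_one_add_log (n + 1)) ht
      linarith
    rw [Real.summable_nat_rpow] at h1
    linarith
  · intro h
    have h1 : Summable fun n : ℕ => (n : ℝ) ^ (-(2 * t)) :=
      Real.summable_nat_rpow.2 (by linarith)
    rw [← summable_nat_add_iff 1] at h1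
    refine h1.of_nonneg_of_le (fun n => by positivity) fun n => ?_
    rw [← hpow (n + 1) n.succ_pos, Real.exp_le_exp]
    have := mul_le_mul_of_nonneg_left (log_add_one_le_harmonic n) ht
    push_cast at this ⊢
    linarith

end Harmonic

end LogLaplacian

end

open LogLaplacian
theorem proposition5p7 :
    (∀ n : ℕ, ∃ h : legendreLp n ∈ intervalLaplacian.domain,
      intervalLaplacian ⟨legendreLp n, h⟩ = (2 * (harmonic n : ℝ)) • legendreLp n) ∧
    intervalLaplacian.HasCore (lipschitzSubmodule lebesgue) ∧
    (∃! T : ℝ≥0 → L2Interval →L[ℝ] L2Interval, IsSemigroupOf intervalLaplacian T) ∧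
    ∀ T : ℝ≥0 → L2Interval →L[ℝ] L2Interval, IsSemigroupOf intervalLaplacian T →
      (∀ t, 0 < t → IsCompactOperator (T t)) ∧
      ∀ t, IsTraceClass (T t) ↔ (1 / 2 : ℝ) < t := by
  have hA := isDiagonalPMap_intervalLaplacian
  have hl : ∀ n, 0 ≤ 2 * (harmonic n : ℝ) := fun n => mul_nonneg zero_le_two (harmonic_nonneg n)
  -- The form determines an operator only if its domain is dense; polynomials provide this.
  have hgraph : intervalLaplacian.graph = formGraph (formDomain lebesgue 1) (logForm lebesgue 1) :=
    formOperator_graph _ _ <| dense_range_polyLp.mono <| by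
      rintro _ ⟨p, rfl⟩
      obtain ⟨u, hu, -⟩ := polyLp_mem_formGraph p
      change (u : L2Interval) = polyLp p at hu
      exact hu ▸ u.2
  refine ⟨fun n => ?_, hA.hasCore ?_ fun n => ?_, hA.existsUnique_semigroup hl, fun T hT =>
    ⟨fun t ht => ?_, fun t => ?_⟩⟩
  · have h := legendreLp_mem_formGraph n
    rw [← hgraph, LinearPMap.mem_graph_iff] at h
    obtain ⟨y, hy, hy'⟩ := h
    change (y : L2Interval) = legendreLp n at hy
    refine ⟨hy ▸ y.2, ?_⟩
    change intervalLaplacian y = (2 * (harmonic n : ℝ)) • legendreLp n at hy'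
    rw [← hy']
    congr
    exact hy.symm
  · rintro f ⟨φ, K, hφ, hf⟩
    have h := mem_formGraph_of_lipschitz hφ hf
    rw [← hgraph] at h
    exact LinearPMap.mem_domain_of_mem_graph h
  · rw [legendreBasis_apply]
    obtain ⟨K, hK⟩ := lipschitzWith_eval (legendre n)
    exact Submodule.smul_mem _ _ ⟨_, K, hK, coeFn_polyLp _⟩
  · refine (hA.isDiagonal hl hT t).isCompactOperator ?_
    refine Real.tendsto_exp_neg_atTop_nhds_zero.comp ?_
    exact (tendsto_harmonic_atTop.const_mul_atTop zero_lt_two).const_mul_atTop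
      (by exact_mod_cast ht)
  · rw [← summable_exp_harmonic_iff t.coe_nonneg]
    exact ⟨(hA.isDiagonal hl hT t).summable_of_isTraceClass fun n => Real.exp_pos _,
      (hA.isDiagonal hl hT t).isTraceClass fun n => (Real.exp_pos _).le⟩
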